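/- Let $K$ be a number field with ring of integers $\mathcal O_K$ and class group $\mathrm{Cl}(K)$, let $\mathfrak n$ be a nonzero ideal of $\mathcal O_K$, and put $\widehat K=K\otimes_{\mathbb Q}\mathbb R$. A lattice is a finitely generated $\mathcal O_K$-submodule $L\subset\widehat K^2$ with $\dim_K KL=2$ and $\widehat KL=\widehat K^2$. If $L\cong\mathcal O_K\oplus\mathfrak b$, we set $\mathrm{cl}(L)=[\mathfrak b]^{-1}$, the inverse of the Steinitz class. For lattices $M\supseteq L$ with $M/L\cong\mathcal O_K/\mathfrak a_1\oplus\mathcal O_K/\mathfrak a_2$, $\mathfrak a_1\mid\mathfrak a_2$, the index ideal is $[M:L]=\mathfrak a_1\mathfrak a_2$; the normalisation of $\mathrm{cl}$ is such that $\mathrm{cl}(M)=[\mathfrak a]\,\mathrm{cl}(L)$ when $[M:L]=\mathfrak a$. Let $\mathcal M$ be either the set $\mathcal M_0(\mathfrak n)$ of pairs $(L,L')$ of lattices with $L\subseteq L'$ and $L'/L\cong\mathcal O_K/\mathfrak n$, or the set $\mathcal M_1(\mathfrak n)$ of triples $(L,L',\beta)$ with $(L,L')\in\mathcal M_0(\mathfrak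 n)$, $L'=L+\mathcal O_K\beta$, and $\beta$ taken modulo $L$. On the $\mathbb Q$-vector space $\mathbb Q\mathcal M$ with basis $\mathcal M$ let $$T_{\mathfrak a}(L,L',\beta)=N(\mathfrak a)^{-1}\sum_{[M:L]=\mathfrak a,\ (M,M+L',\beta)\in\mathcal M}(M,M+L',\beta)$$ for nonzero integral ideals $\mathfrak a$, and $$T_{\mathfrak a,\mathfrak a}(L,L',\beta)=N(\mathfrak a)^{-2}(\mathfrak a^{-1}L,\mathfrak a^{-1}L',\beta)$$ for fractional ideals $\mathfrak a$ coprime to $\mathfrak n$, with the representative $\beta$ chosen in $L'\cap\mathfrak a^{-1}L'$ (omit $\beta$ for $\mathcal M_0(\mathfrak n)$). Let $\mathbb T$ be the $\mathbb Q$-algebra of operators generated by all $T_{\mathfrak a}$ and $T_{\mathfrak a,\mathfrak a}$. An eigensystem is a ring homomorphism $\lambda:\mathbb T\to\mathbb C$; write $\lambda=(\alpha,\chi)$ with $\alpha(\mathfrak a)=\lambda(T_{\mathfrak a})$ and $\chi(\mathfrak a)=\lambda(T_{\mathfrak a,\mathfrak a})$. An unramified character is a homomorphism $\psi:\mathrm{Cl}(K)\to\mathbb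 C^\times$; put $\psi(\mathfrak a)=\psi([\mathfrak a])$. A graded $\mathbb T$-module is a complex vector space $V=\bigoplus_{c\in\mathrm{Cl}(K)}V_c$ with an action of $\mathbb T$ by $\mathbb C$-linear maps such that $T_{\mathfrak a}V_c\subseteq V_{[\mathfrak a]c}$ and $T_{\mathfrak a,\mathfrak a}V_c\subseteq V_{[\mathfrak a]^2c}$ for all $c$. An eigenvector with eigensystem $\lambda$ is a nonzero $v\in V$ with $Tv=\lambda(T)v$ for all $T\in\mathbb T$. For $v=\sum_cv_c$ with $v_c\in V_c$ put $v\otimes\psi=\sum_c\psi^{-1}(c)v_c$. **Proposition.** Let $\lambda=(\alpha,\chi)$ be an eigensystem and $\psi$ an unramified character. 1. There is exactly one eigensystem $\lambda\otimes\psi=(\alpha\psi,\chi\psi^2)$, that is, with $(\lambda\otimes\psi)(T_{\mathfrak a})=\psi(\mathfrak a)\lambda(T_{\mathfrak a})$ for all nonzero integral $\mathfrak a$ and $(\lambda\otimes\psi)(T_{\mathfrak a,\mathfrak a})=\psi(\mathfrak a)^2\lambda(T_{\mathfrak a,\mathfrak a})$ for all fractional $\mathfrak a$ coprime to $\mathfrak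 n$. 2. The space $\mathbb C\mathcal M=\bigoplus_c\mathbb C\mathcal M^{(c)}$, where $\mathbb C\mathcal M^{(c)}$ is spanned by the modular points whose underlying lattice $L$ has $\mathrm{cl}(L)=c$, is a graded $\mathbb T$-module. 3. If $v=\sum_cv_c$ is a simultaneous eigenvector with eigensystem $\lambda$ in $\mathbb C\mathcal M$, or in any graded $\mathbb T$-module, then $v\otimes\psi$ is again a simultaneous eigenvector, with eigensystem $\lambda\otimes\psi$. -/

import Mathlib

open scoped nonZeroDivisors TensorProduct NumberField

noncomputable section

namespace Hecke

/-! ## Lattices -/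

/-- The real algebra `K ⊗_ℚ ℝ ≅ ℝ^{r₁} × ℂ^{r₂}` attached to a number field. -/
abbrev KHat (K : Type*) [Field K] [NumberField K] : Type _ := K ⊗[ℚ] ℝ

/-- The space of row vectors `K̂ ⊕ K̂`. -/
abbrev KHatSq (K : Type*) [Field K] [NumberField K] : Type _ := Fin 2 → KHat K

/-- An `𝓞_K`-lattice in `K̂²`: a finitely generated `𝓞_K`-submodule `L` with
`dim_K (K L) = 2` and `K̂ L = K̂²`. -/
structure IsLattice {K : Type*} [Field K] [NumberField K]
    (L : Submodule (𝓞 K) (KHatSq K)) : Prop where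
  fg : L.FG
  finrank_span : Module.finrank K (Submodule.span K (L : Set (KHatSq K))) = 2
  span_eq_top : Submodule.span (KHat K) (L : Set (KHatSq K)) = ⊤

/-- The product `I L`, for a fractional ideal `I`: all finite sums `∑ aᵢ xᵢ` with
`aᵢ ∈ I` and `xᵢ ∈ L`. -/
def fracSMul {K : Type*} [Field K] [NumberField K]
    (I : FractionalIdeal (𝓞 K)⁰ K) (L : Submodule (𝓞 K) (KHatSq K)) :
    Submodule (𝓞 K) (KHatSq K) :=
  Submodule.span (𝓞 K) {z | ∃ a ∈ I, ∃ x ∈ L, z = a • x}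

/-- `M ⊇ L` has index ideal `[M : L] = 𝔞`: the elementary divisors `𝔞₁ ∣ 𝔞₂` of `M / L`
have product `𝔞`. -/
def HasIndexIdeal {K : Type*} [Field K] [NumberField K]
    (L M : Submodule (𝓞 K) (KHatSq K)) (a : Ideal (𝓞 K)) : Prop :=
  L ≤ M ∧ ∃ a₁ a₂ : Ideal (𝓞 K), a₁ ∣ a₂ ∧ a₁ * a₂ = a ∧
    Nonempty ((M ⧸ L.submoduleOf M) ≃ₗ[𝓞 K] ((𝓞 K ⧸ a₁) × (𝓞 K ⧸ a₂)))

/-- `L` has Steinitz class `c`: it is isomorphic to `𝓞_K ⊕ 𝔟` for an ideal `𝔟` of class `c`. -/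
def HasSteinitzClass {K : Type*} [Field K] [NumberField K]
    (L : Submodule (𝓞 K) (KHatSq K)) (c : ClassGroup (𝓞 K)) : Prop :=
  ∃ b : (Ideal (𝓞 K))⁰, ClassGroup.mk0 b = c ∧
    Nonempty (L ≃ₗ[𝓞 K] (𝓞 K × (b : Ideal (𝓞 K))))

open Classical in
/-- The Steinitz class of a lattice. (Every lattice has exactly one; the default value `1` is
used only for submodules which are not lattices.) -/
def steinitzClass {K : Type*} [Field K] [NumberField K]
    (L : Submodule (𝓞 K) (KHatSq K)) : ClassGroup (𝓞 K) :=
  if h : ∃ c, HasSteinitzClass L c then h.choose else 1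

/-- The ideal class by which lattices are graded, normalised so that `[M] = [𝔞] [L]` whenever
`M ⊇ L` has index ideal `𝔞`. As the Steinitz class of `𝔞₁ 𝔟₁ ⊕ 𝔞₂ 𝔟₂` is `[𝔞₁ 𝔞₂]` times that of
`𝔟₁ ⊕ 𝔟₂`, this is the inverse of the Steinitz class. -/
def latticeClass {K : Type*} [Field K] [NumberField K]
    (L : Submodule (𝓞 K) (KHatSq K)) : ClassGroup (𝓞 K) :=
  (steinitzClass L)⁻¹

/-! ## Modular points -/

/-- A modular point for `Γ₀(𝔫)`: lattices `L ⊆ L'` with `L' / L ≅ 𝓞_K / 𝔫`. -/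
@[ext]
structure ModularPoint₀ (K : Type*) [Field K] [NumberField K] (n : Ideal (𝓞 K)) where
  L : Submodule (𝓞 K) (KHatSq K)
  L' : Submodule (𝓞 K) (KHatSq K)
  isLattice : IsLattice L
  isLattice' : IsLattice L'
  le : L ≤ L'
  quot : Nonempty ((L' ⧸ L.submoduleOf L') ≃ₗ[𝓞 K] (𝓞 K ⧸ n))

/-- A modular point `(L, L', β)` for `Γ₁(𝔫)`: a modular point for `Γ₀(𝔫)` with a generator `β`
of the `𝓞_K`-module `L' / L`. As `β` only matters modulo `L`, the coset `β + L` is recorded. -/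
@[ext]
structure ModularPoint₁ (K : Type*) [Field K] [NumberField K] (n : Ideal (𝓞 K)) extends
    ModularPoint₀ K n where
  coset : Set (KHatSq K)
  coset_spec : ∃ β : KHatSq K, coset = {x | x - β ∈ L} ∧ L' = L ⊔ Submodule.span (𝓞 K) {β}

/-- The two kinds of level structure. -/
inductive LevelKind
  | gamma0
  | gamma1

/-- The set `𝓜 = 𝓜₀(𝔫)` or `𝓜₁(𝔫)` of modular points. -/
def ModularPoint (K : Type*) [Field K] [NumberField K] (k : LevelKind) (n : Ideal (𝓞 K)) :
    Type _ :=
  match k with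
  | .gamma0 => ModularPoint₀ K n
  | .gamma1 => ModularPoint₁ K n

/-- The underlying modular point `(L, L')` for `Γ₀(𝔫)`. -/
def ModularPoint.base {K : Type*} [Field K] [NumberField K] {n : Ideal (𝓞 K)} :
    {k : LevelKind} → ModularPoint K k n → ModularPoint₀ K n
  | .gamma0, P => P
  | .gamma1, P => ModularPoint₁.toModularPoint₀ P

/-- The class of a modular point is the class of its underlying lattice. -/
def ModularPoint.cls {K : Type*} [Field K] [NumberField K] {k : LevelKind} {n : Ideal (𝓞 K)}
    (P : ModularPoint K k n) : ClassGroup (𝓞 K) :=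
  latticeClass P.base.L

/-! ## Hecke operators -/

/-- The group of fractional ideals coprime to `𝔫`. -/
def coprimeIdeals (K : Type*) [Field K] [NumberField K] (n : Ideal (𝓞 K)) :
    Subgroup (FractionalIdeal (𝓞 K)⁰ K)ˣ where
  carrier := {I | ∀ v : IsDedekindDomain.HeightOneSpectrum (𝓞 K), v.asIdeal ∣ n →
    FractionalIdeal.count K v (I : FractionalIdeal (𝓞 K)⁰ K) = 0}
  mul_mem' {I J} hI hJ v hv := by
    rw [Units.val_mul, FractionalIdeal.count_mul K v I.ne_zero J.ne_zero, hI v hv, hJ v hv,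
      add_zero]
  one_mem' v _ := by
    rw [Units.val_one, FractionalIdeal.count_one]
  inv_mem' {I} hI v hv := by
    rw [Units.val_inv_eq_inv_val, FractionalIdeal.count_inv, hI v hv, neg_zero]

/-- The modular points `Q = (M, M', β)` which occur in `T_𝔞 P` for `P = (L, L', β)`: those with
`[M : L] = 𝔞` and `M' = M + L'`, with the same `β` (that is, `β + L ⊆ β + M`) in the case of
`Γ₁(𝔫)`. -/
def RelT {K : Type*} [Field K] [NumberField K] {n : Ideal (𝓞 K)} (a : (Ideal (𝓞 K))⁰) :
    (k : LevelKind) → ModularPoint K k n → ModularPoint K k n → Prop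
  | .gamma0, P, Q => HasIndexIdeal P.base.L Q.base.L a ∧ Q.base.L' = Q.base.L ⊔ P.base.L'
  | .gamma1, P, Q => HasIndexIdeal P.base.L Q.base.L a ∧ Q.base.L' = Q.base.L ⊔ P.base.L' ∧
      ModularPoint₁.coset P ⊆ ModularPoint₁.coset Q

/-- The modular point `Q = (𝔞⁻¹ L, 𝔞⁻¹ L', β)` which occurs in `T_{𝔞,𝔞} P` for `P = (L, L', β)`.
In the case of `Γ₁(𝔫)`, the representative `β` is chosen in `L' ∩ 𝔞⁻¹ L'`, so `Q` is
characterised by `β + L` and its own coset `β + 𝔞⁻¹ L` having an element in common. -/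
def RelTT {K : Type*} [Field K] [NumberField K] {n : Ideal (𝓞 K)}
    (a : (FractionalIdeal (𝓞 K)⁰ K)ˣ) :
    (k : LevelKind) → ModularPoint K k n → ModularPoint K k n → Prop
  | .gamma0, P, Q => Q.base.L = fracSMul (a⁻¹ : (FractionalIdeal (𝓞 K)⁰ K)ˣ) P.base.L ∧
      Q.base.L' = fracSMul (a⁻¹ : (FractionalIdeal (𝓞 K)⁰ K)ˣ) P.base.L'
  | .gamma1, P, Q => Q.base.L = fracSMul (a⁻¹ : (FractionalIdeal (𝓞 K)⁰ K)ˣ) P.base.L ∧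
      Q.base.L' = fracSMul (a⁻¹ : (FractionalIdeal (𝓞 K)⁰ K)ˣ) P.base.L' ∧
      (ModularPoint₁.coset P ∩ ModularPoint₁.coset Q).Nonempty

/-- The `ℚ`-linear operator `P ↦ q ∑_{Q : R P Q} Q` on the formal `ℚ`-linear combinations of
elements of `X`. (It is used only where these sums are finite.) -/
def relOperator {X : Type*} (q : ℚ) (R : X → X → Prop) : Module.End ℚ (X →₀ ℚ) :=
  Finsupp.linearCombination ℚ fun P => q • ∑ᶠ (Q : X) (_ : R P Q), Finsupp.single Q (1 : ℚ)

/-- The Hecke operator `T_𝔞` on `ℚ𝓜`, with scaling factor `N(𝔞)⁻¹`. -/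
def opT {K : Type*} [Field K] [NumberField K] (k : LevelKind) (n : Ideal (𝓞 K))
    (a : (Ideal (𝓞 K))⁰) : Module.End ℚ (ModularPoint K k n →₀ ℚ) :=
  relOperator ((Ideal.absNorm (a : Ideal (𝓞 K)) : ℚ)⁻¹) (RelT a k)

/-- The Hecke operator `T_{𝔞,𝔞}` on `ℚ𝓜`, with scaling factor `N(𝔞)⁻²`. -/
def opTT {K : Type*} [Field K] [NumberField K] (k : LevelKind) (n : Ideal (𝓞 K))
    (a : coprimeIdeals K n) : Module.End ℚ (ModularPoint K k n →₀ ℚ) :=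
  relOperator
    ((FractionalIdeal.absNorm ((a : (FractionalIdeal (𝓞 K)⁰ K)ˣ) : FractionalIdeal (𝓞 K)⁰ K) ^ 2)⁻¹)
    (RelTT (a : (FractionalIdeal (𝓞 K)⁰ K)ˣ) k)

/-- The Hecke algebra `𝕋`: the `ℚ`-algebra generated by all `T_𝔞`, for integral ideals `𝔞`, and
all `T_{𝔞,𝔞}`, for fractional ideals `𝔞` coprime to `𝔫`. -/
def heckeAlgebra (K : Type*) [Field K] [NumberField K] (k : LevelKind) (n : Ideal (𝓞 K)) :
    Subalgebra ℚ (Module.End ℚ (ModularPoint K k n →₀ ℚ)) :=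
  Algebra.adjoin ℚ (Set.range (opT k n) ∪ Set.range (opTT k n))

/-- `T_𝔞` as an element of `𝕋`. -/
def heckeT {K : Type*} [Field K] [NumberField K] (k : LevelKind) (n : Ideal (𝓞 K))
    (a : (Ideal (𝓞 K))⁰) : heckeAlgebra K k n :=
  ⟨opT k n a, Algebra.subset_adjoin (Or.inl ⟨a, rfl⟩)⟩

/-- `T_{𝔞,𝔞}` as an element of `𝕋`. -/
def heckeTT {K : Type*} [Field K] [NumberField K] (k : LevelKind) (n : Ideal (𝓞 K))
    (a : coprimeIdeals K n) : heckeAlgebra K k n :=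
  ⟨opTT k n a, Algebra.subset_adjoin (Or.inr ⟨a, rfl⟩)⟩

/-! ## The action on `ℂ𝓜` -/

theorem complexify_aux {X : Type*} (T : Module.End ℚ (X →₀ ℚ)) (x : X →₀ ℚ) :
    Finsupp.linearCombination ℂ
      (fun P => (T (Finsupp.single P 1)).mapRange (algebraMap ℚ ℂ) (map_zero _))
      (x.mapRange (algebraMap ℚ ℂ) (map_zero _)) =
    (T x).mapRange (algebraMap ℚ ℂ) (map_zero _) := by
  induction x using Finsupp.induction_linear with
  | zero => simp
  | add x y hx hy =>
    rw [Finsupp.mapRange_add (map_add _), map_add, hx, hy, map_add,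
      Finsupp.mapRange_add (map_add _)]
  | single P q =>
    have h : Finsupp.single P q = q • Finsupp.single P (1 : ℚ) := by simp
    rw [Finsupp.mapRange_single, Finsupp.linearCombination_single, h, map_smul]
    ext Q
    simp

/-- Extension of scalars from `ℚ` to `ℂ` for operators on formal linear combinations. -/
def complexify (X : Type*) : Module.End ℚ (X →₀ ℚ) →+* Module.End ℂ (X →₀ ℂ) where
  toFun T := Finsupp.linearCombination ℂ fun P =>
    (T (Finsupp.single P 1)).mapRange (algebraMap ℚ ℂ) (map_zero _)
  map_one' := by
    ext P : 2
    simp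
  map_mul' S T := by
    ext P : 2
    simp [complexify_aux]
  map_zero' := by
    ext P : 2
    simp
  map_add' S T := by
    ext P : 2
    simp [Finsupp.mapRange_add (map_add (algebraMap ℚ ℂ))]

/-- The action of `𝕋` on `ℂ𝓜`. -/
def complexAction (K : Type*) [Field K] [NumberField K] (k : LevelKind) (n : Ideal (𝓞 K)) :
    heckeAlgebra K k n →+* Module.End ℂ (ModularPoint K k n →₀ ℂ) :=
  (complexify (ModularPoint K k n)).comp (heckeAlgebra K k n).val.toRingHom

/-- The subspace `ℂ𝓜^(c)` spanned by the modular points of class `c`. -/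
def complexPart (K : Type*) [Field K] [NumberField K] (k : LevelKind) (n : Ideal (𝓞 K))
    (c : ClassGroup (𝓞 K)) : Submodule ℂ (ModularPoint K k n →₀ ℂ) :=
  Finsupp.supported ℂ ℂ {P | P.cls = c}

open Classical in
/-- The component `v_c ∈ ℂ𝓜^(c)` of `v ∈ ℂ𝓜`. -/
def component {K : Type*} [Field K] [NumberField K] {k : LevelKind} {n : Ideal (𝓞 K)}
    (c : ClassGroup (𝓞 K)) (v : ModularPoint K k n →₀ ℂ) : ModularPoint K k n →₀ ℂ :=
  v.filter fun P => P.cls = c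

/-- The twist `v ⊗ ψ = ∑_c ψ⁻¹(c) v_c` of `v ∈ ℂ𝓜`. -/
def twistVector {K : Type*} [Field K] [NumberField K] {k : LevelKind} {n : Ideal (𝓞 K)}
    (ψ : ClassGroup (𝓞 K) →* ℂˣ) (v : ModularPoint K k n →₀ ℂ) : ModularPoint K k n →₀ ℂ :=
  ∑ c : ClassGroup (𝓞 K), ((ψ⁻¹ c : ℂˣ) : ℂ) • component c v

/-! ## Eigensystems and eigenvectors -/

/-- The eigensystem `lam' : 𝕋 → ℂ` is the twist `lam ⊗ ψ = (α ψ, χ ψ²)` of `lam = (α, χ)` by the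
unramified character `ψ`, where `α(𝔞) = lam(T_𝔞)` and `χ(𝔞) = lam(T_{𝔞,𝔞})`. -/
structure IsTwist {K : Type*} [Field K] [NumberField K] {k : LevelKind} {n : Ideal (𝓞 K)}
    (ψ : ClassGroup (𝓞 K) →* ℂˣ) (lam lam' : heckeAlgebra K k n →+* ℂ) : Prop where
  apply_T : ∀ a : (Ideal (𝓞 K))⁰,
    lam' (heckeT k n a) = lam (heckeT k n a) * (ψ (ClassGroup.mk0 a) : ℂ)
  apply_TT : ∀ a : coprimeIdeals K n,
    lam' (heckeTT k n a) = lam (heckeTT k n a) *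
      (ψ (ClassGroup.mk (R := 𝓞 K) (K := K) a.1) : ℂ) ^ 2

/-- `v` is a simultaneous eigenvector, with eigensystem `lam`, for the action `ρ` of `𝕋` on `V`. -/
def IsEigenvector {K : Type*} [Field K] [NumberField K] {k : LevelKind} {n : Ideal (𝓞 K)}
    {V : Type*} [AddCommGroup V] [Module ℂ V] (ρ : heckeAlgebra K k n →+* Module.End ℂ V)
    (lam : heckeAlgebra K k n →+* ℂ) (v : V) : Prop :=
  v ≠ 0 ∧ ∀ T : heckeAlgebra K k n, ρ T v = lam T • v

/-- The action `ρ` of `𝕋` on `V` is graded by the class group: `V = ⨁_c V_c`, with `T_𝔞` of class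
`[𝔞]` and `T_{𝔞,𝔞}` of class `[𝔞]²`, where an operator of class `c₀` maps each `V_c` into
`V_{c₀ c}`. -/
structure IsGradedAction {K : Type*} [Field K] [NumberField K] {k : LevelKind} {n : Ideal (𝓞 K)}
    {V : Type*} [AddCommGroup V] [Module ℂ V] (ρ : heckeAlgebra K k n →+* Module.End ℂ V)
    (W : ClassGroup (𝓞 K) → Submodule ℂ V) : Prop where
  indep : iSupIndep W
  iSup_eq_top : ⨆ c, W c = ⊤
  map_T : ∀ (a : (Ideal (𝓞 K))⁰) (c : ClassGroup (𝓞 K)), ∀ v ∈ W c,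
    ρ (heckeT k n a) v ∈ W (ClassGroup.mk0 a * c)
  map_TT : ∀ (a : coprimeIdeals K n) (c : ClassGroup (𝓞 K)), ∀ v ∈ W c,
    ρ (heckeTT k n a) v ∈ W (ClassGroup.mk (R := 𝓞 K) (K := K) a.1 ^ 2 * c)

end Hecke

end

noncomputable section

namespace Hecke

set_option linter.unusedSectionVars false

section Dedekind

/-! The point is that the generators of the Hecke algebra are homogeneous for the class group: `T_𝔞`
multiplies the class of a modular point by `[𝔞]` and `T_{𝔞,𝔞}` by `[𝔞]²`.

This is read off from the ideal generated by the determinants of pairs of vectors of `L`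
(`detSpan`), in coordinates on the `K`-span. If `L ≅ 𝓞_K ⊕ 𝔟`, this ideal is a principal multiple of
`𝔟` (`detSpan_eq_of_linearEquiv`); it is multiplied by `𝔞` on passing from `M` to a sublattice of
index ideal `𝔞` (`detSpan_eq_mul_of_quotient`), and by `I²` on passing from `L` to `I L`
(`detSpan_fracSMul`).

Since the generators are homogeneous, the homogeneous components `T_c` of a Hecke operator `T` lie
again in the Hecke algebra (`degreePart_mem_adjoin`), and `λ'(T) = ∑ λ(T_c) ψ(c)` is multiplicative
because `ψ` is (`exists_twist`). Its values on generators determine it.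

If `T` has degree `d` and `T v = z v`, comparing components gives `T v_c = z v_{dc}`; as `ψ⁻¹(c) =
ψ(d) ψ⁻¹(dc)`, the twisted vector has eigenvalue `z ψ(d)` (`apply_twist_eq`). Generators suffice,
because the eigenvector equation is preserved under sums and products. -/

theorem isTorsionFree_of_isFractionRing (R K E : Type*) [CommRing R] [IsDomain R] [Field K]
    [Algebra R K] [IsFractionRing R K] [AddCommGroup E] [Module R E] [Module K E]
    [IsScalarTower R K E] : Module.IsTorsionFree R E :=
  .trans_faithfulSMul R K E

variable {R K E : Type*} [CommRing R] [IsDedekindDomain R] [Field K] [Algebra R K]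
  [IsFractionRing R K] [AddCommGroup E] [Module R E] [Module K E] [IsScalarTower R K E]

/-! ### Modules of rank two over a Dedekind domain -/

theorem projective_of_fg [Module.IsTorsionFree R E] (L : Submodule R E) (hL : L.FG) :
    Module.Projective R L := by
  have : Module.Finite R L := Module.Finite.iff_fg.mpr hL
  have : Module.FinitePresentation R L := Module.finitePresentation_of_finite R L
  exact Module.Flat.projective_of_finitePresentation

/-- Coordinates on the `K`-span of a submodule of rank two, with respect to a `K`-basis consisting
of elements of the submodule. -/
theorem exists_coordinates (L : Submodule R E)
    (h : Module.finrank K (Submodule.span K (L : Set E)) = 2) :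
    ∃ D : E →ₗ[K] (Fin 2 → K), Set.InjOn D (Submodule.span K (L : Set E)) ∧
      ∃ p ∈ L, ∃ q ∈ L, D p = ![1, 0] ∧ D q = ![0, 1] := by
  obtain ⟨B, hBL, hspan, hli⟩ := exists_linearIndependent K (L : Set E)
  let v := Module.Basis.span hli
  have hcard : Nat.card B = 2 := by
    rw [← Module.finrank_eq_nat_card_basis v, Subtype.range_coe, hspan, h]
  have : Finite B := Nat.finite_of_card_ne_zero (by rw [hcard]; exact two_ne_zero)
  let w := v.reindex (Finite.equivFinOfCardEq hcard)
  have hw : ∀ i, ((w i : Submodule.span K (Set.range ((↑) : B → E))) : E) ∈ L := by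
    intro i
    rw [Module.Basis.reindex_apply, Module.Basis.span_apply]
    exact hBL (Subtype.coe_prop _)
  -- `E` may be larger than the span, so the coordinates are extended arbitrarily and are faithful
  -- only on the span.
  obtain ⟨D, hD⟩ := w.equivFun.toLinearMap.exists_extend
  have hDw : ∀ x, D ((x : Submodule.span K (Set.range ((↑) : B → E))) : E) = w.equivFun x :=
    fun x => LinearMap.congr_fun hD x
  have hspan' : Submodule.span K (Set.range ((↑) : B → E)) = Submodule.span K (L : Set E) := by
    rw [Subtype.range_coe, hspan]
  refine ⟨D, fun x hx y hy hxy => ?_, w 0, hw 0, w 1, hw 1, ?_, ?_⟩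
  · rw [SetLike.mem_coe, ← hspan'] at hx hy
    have := (hDw ⟨x, hx⟩).symm.trans (hxy.trans (hDw ⟨y, hy⟩))
    exact congrArg Subtype.val (w.equivFun.injective this)
  · rw [hDw]
    ext i; fin_cases i <;> simp
  · rw [hDw]
    ext i; fin_cases i <;> simp

/-- Such an `N` is a fractional ideal; clearing denominators makes it integral. -/
theorem exists_ideal_linearEquiv (N : Submodule R K) (hN : N.FG) :
    ∃ I : Ideal R, Nonempty (N ≃ₗ[R] I) := by
  let J : FractionalIdeal R⁰ K := ⟨N, FractionalIdeal.isFractional_of_fg hN⟩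
  exact ⟨J.num, ⟨FractionalIdeal.equivNum (I := J) (nonZeroDivisors.coe_ne_zero _)⟩⟩

theorem linearEquiv_of_spanSingleton_mul_eq {I J : Ideal R} {x : K} (hx : x ≠ 0)
    (h : FractionalIdeal.spanSingleton R⁰ x * (I : FractionalIdeal R⁰ K) = J) :
    Nonempty (I ≃ₗ[R] J) := by
  have hinj : Function.Injective (Algebra.linearMap R K) := IsFractionRing.injective R K
  have hinj' : Function.Injective (LinearMap.mulLeft R x) := mul_right_injective₀ hx
  have key : (Submodule.map (Algebra.linearMap R K) I).map (LinearMap.mulLeft R x) =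
      Submodule.map (Algebra.linearMap R K) (J : Submodule R R) := by
    have := congrArg (fun A : FractionalIdeal R⁰ K => (A : Submodule R K)) h
    simp only [FractionalIdeal.coe_mul, FractionalIdeal.coe_spanSingleton,
      FractionalIdeal.coe_coeIdeal] at this
    rw [← show IsLocalization.coeSubmodule K J = Submodule.map (Algebra.linearMap R K) (J : Submodule R R) from rfl,
      ← this]
    ext y
    rw [Submodule.mem_span_singleton_mul]
    rfl
  exact ⟨(Submodule.equivMapOfInjective _ hinj I).trans
    ((Submodule.equivMapOfInjective _ hinj' _).trans
      ((LinearEquiv.ofEq _ _ key).trans (Submodule.equivMapOfInjective _ hinj J).symm))⟩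

/-- Addition gives an exact sequence `0 → I ∩ J → I × J → R → 0`, which splits because `R` is
projective. -/
theorem prod_linearEquiv_of_sup_eq_top {I J : Ideal R} (h : I ⊔ J = ⊤) :
    Nonempty ((I × J) ≃ₗ[R] (R × (I ⊓ J : Ideal R))) := by
  let g : (I × J) →ₗ[R] R := (Submodule.subtype I).coprod (Submodule.subtype J)
  let f : (I ⊓ J : Ideal R) →ₗ[R] (I × J) :=
    (Submodule.inclusion inf_le_left).prod (-(Submodule.inclusion inf_le_right))
  have hg : Function.Surjective g := by
    intro r
    obtain ⟨a, ha, b, hb, rfl⟩ := Submodule.mem_sup.mp (h ▸ Submodule.mem_top (x := r) : r ∈ I ⊔ J)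
    exact ⟨(⟨a, ha⟩, ⟨b, hb⟩), rfl⟩
  have hf : Function.Injective f := by
    intro a b hab
    exact Subtype.ext (congrArg (fun z : I × J => (z.1 : R)) hab)
  have hex : Function.Exact f g := by
    rintro ⟨⟨a, ha⟩, ⟨b, hb⟩⟩
    constructor
    · intro hab
      have hab : a + b = 0 := hab
      refine ⟨⟨a, ha, ?_⟩, ?_⟩
      · rw [eq_neg_of_add_eq_zero_left hab]
        exact neg_mem hb
      · ext
        · rfl
        · exact (eq_neg_of_add_eq_zero_right hab).symm
    · rintro ⟨t, ht⟩
      rw [← ht]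
      simp [f, g]
  obtain ⟨s, hs⟩ := Module.projective_lifting_property g .id hg
  exact ⟨(hex.splitSurjectiveEquiv hf ⟨s, hs⟩).1.trans (LinearEquiv.prodComm R _ _)⟩

/-- Scaling by a suitable `x` replaces `I` by an isomorphic ideal coprime to `J`, which reduces to
the coprime case. -/
theorem prod_ideal_linearEquiv {I J : Ideal R} (hI : I ≠ ⊥) (hJ : J ≠ ⊥) :
    ∃ b : Ideal R, b ≠ ⊥ ∧ Nonempty ((I × J) ≃ₗ[R] (R × b)) := by
  let K := FractionRing R
  obtain ⟨x, hx⟩ := IsDedekindDomain.exists_add_spanSingleton_mul_eq (R := R) (K := K)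
    (a := J) (b := I) (c := 1) FractionalIdeal.coeIdeal_le_one
    (FractionalIdeal.coeIdeal_ne_zero.mpr hJ) (FractionalIdeal.coeIdeal_ne_zero.mpr hI)
  -- Scaling by `x = 0` is no isomorphism, but then `J` is already the unit ideal.
  by_cases hx0 : x = 0
  · subst hx0
    have hJ : J = ⊤ := by
      rw [FractionalIdeal.spanSingleton_zero, zero_mul, add_zero] at hx
      exact Ideal.one_eq_top (R := R) ▸ FractionalIdeal.coeIdeal_eq_one.mp hx
    subst hJ
    exact ⟨I, hI, ⟨(LinearEquiv.prodComm R _ _).trans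
      (LinearEquiv.prodCongr Submodule.topEquiv (LinearEquiv.refl R I))⟩⟩
  · obtain ⟨A, hA⟩ := FractionalIdeal.le_one_iff_exists_coeIdeal.mp
      (show FractionalIdeal.spanSingleton R⁰ x * (I : FractionalIdeal R⁰ K) ≤ 1 by
        rw [← hx]; exact le_add_of_nonneg_left (FractionalIdeal.zero_le _))
    obtain ⟨e⟩ := linearEquiv_of_spanSingleton_mul_eq hx0 hA.symm
    have hA0 : A ≠ ⊥ := by
      rw [← FractionalIdeal.coeIdeal_ne_zero (K := K), hA]
      exact mul_ne_zero (FractionalIdeal.spanSingleton_ne_zero_iff.mpr hx0)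
        (FractionalIdeal.coeIdeal_ne_zero.mpr hI)
    have hsup : A ⊔ J = ⊤ := by
      rw [← hA, ← FractionalIdeal.coeIdeal_sup] at hx
      rwa [FractionalIdeal.coeIdeal_eq_one, Ideal.one_eq_top, sup_comm] at hx
    obtain ⟨e'⟩ := prod_linearEquiv_of_sup_eq_top hsup
    refine ⟨A ⊓ J, fun h0 => ?_, ⟨(LinearEquiv.prodCongr e (LinearEquiv.refl R J)).trans e'⟩⟩
    have := Ideal.mul_le_inf (I := A) (J := J)
    rw [h0, le_bot_iff, ← Ideal.zero_eq_bot, mul_eq_zero] at this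
    exact this.elim hA0 hJ

/-- The first coordinate maps `L` onto a projective submodule of `K`, so `L` splits; the second
coordinate embeds the kernel in `K`. Both summands are thus isomorphic to ideals, which are nonzero
because `L` contains `q` and `p` with coordinates `(0, 1)` and `(1, 0)`. -/
theorem exists_linearEquiv_prod_ideal (L : Submodule R E) (hL : L.FG)
    (h : Module.finrank K (Submodule.span K (L : Set E)) = 2) :
    ∃ b : Ideal R, b ≠ ⊥ ∧ Nonempty (L ≃ₗ[R] (R × b)) := by
  obtain ⟨D, hD, p, hp, q, hq, hDp, hDq⟩ := exists_coordinates L h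
  have hfin : Module.Finite R L := Module.Finite.iff_fg.mpr hL
  let f : L →ₗ[R] K := ((LinearMap.proj 0 ∘ₗ D).restrictScalars R) ∘ₗ L.subtype
  let g : LinearMap.ker f →ₗ[R] K :=
    ((LinearMap.proj 1 ∘ₗ D).restrictScalars R) ∘ₗ L.subtype ∘ₗ (LinearMap.ker f).subtype
  have hg : Function.Injective g := by
    intro a b hab
    refine Subtype.ext (Subtype.ext (hD (Submodule.subset_span a.1.2)
      (Submodule.subset_span b.1.2) (funext fun i => ?_)))
    fin_cases i
    · exact (LinearMap.mem_ker.mp a.2).trans (LinearMap.mem_ker.mp b.2).symm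
    · exact hab
  have hproj : Module.Projective R (LinearMap.range f) :=
    projective_of_fg _ (Module.Finite.iff_fg.mp inferInstance)
  obtain ⟨s, hs⟩ := Module.projective_lifting_property f.rangeRestrict .id
    f.surjective_rangeRestrict
  have hex : Function.Exact (LinearMap.ker f).subtype f.rangeRestrict := by
    rw [LinearMap.exact_iff, LinearMap.ker_rangeRestrict, Submodule.range_subtype]
  let e := (hex.splitSurjectiveEquiv (LinearMap.ker f).injective_subtype ⟨s, hs⟩).1
  obtain ⟨I, ⟨eI⟩⟩ := exists_ideal_linearEquiv (LinearMap.range g)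
    (Module.Finite.iff_fg.mp inferInstance)
  obtain ⟨J, ⟨eJ⟩⟩ := exists_ideal_linearEquiv (LinearMap.range f)
    (Module.Finite.iff_fg.mp inferInstance)
  have eI' := (LinearEquiv.ofInjective g hg).trans eI
  have hI : I ≠ ⊥ := by
    rintro rfl
    have hq0 : (⟨q, hq⟩ : L) ∈ LinearMap.ker f := by
      simp [f, hDq]
    have h1 : (⟨⟨q, hq⟩, hq0⟩ : LinearMap.ker f) = 0 := eI'.injective (Subsingleton.elim _ _)
    have h2 : g ⟨⟨q, hq⟩, hq0⟩ = 1 := by simp [g, hDq]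
    rw [h1, map_zero] at h2
    exact zero_ne_one h2
  have hJ : J ≠ ⊥ := by
    rintro rfl
    have h1 : f.rangeRestrict ⟨p, hp⟩ = 0 := eJ.injective (Subsingleton.elim _ _)
    have h2 : f ⟨p, hp⟩ = 1 := by simp [f, hDp]
    have h3 := congrArg Subtype.val h1
    exact one_ne_zero (h2.symm.trans h3)
  obtain ⟨b, hb, ⟨e'⟩⟩ := prod_ideal_linearEquiv hI hJ
  exact ⟨b, hb, ⟨(e.trans (LinearEquiv.prodCongr eI' eJ)).trans e'⟩⟩

/-! ### The ideal of determinants -/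

/-- The determinant of two vectors, in coordinates `D`. -/
def pairDet (D : E →ₗ[K] (Fin 2 → K)) (x y : E) : K := D x 0 * D y 1 - D x 1 * D y 0

section

variable (D : E →ₗ[K] (Fin 2 → K)) (x y z : E) (r : R)

theorem pairDet_self : pairDet D x x = 0 := by
  rw [pairDet, mul_comm, sub_self]

theorem pairDet_add_left : pairDet D (x + y) z = pairDet D x z + pairDet D y z := by
  simp only [pairDet, map_add, Pi.add_apply]
  ring

theorem pairDet_add_right : pairDet D x (y + z) = pairDet D x y + pairDet D x z := by
  simp only [pairDet, map_add, Pi.add_apply]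
  ring

theorem pairDet_zero_left : pairDet D 0 x = 0 := by
  simp [pairDet]

theorem pairDet_zero_right : pairDet D x 0 = 0 := by
  simp [pairDet]

theorem pairDet_smul_left' (c : K) : pairDet D (c • x) y = c * pairDet D x y := by
  simp only [pairDet, map_smul, Pi.smul_apply, smul_eq_mul]
  ring

theorem pairDet_smul_right' (c : K) : pairDet D x (c • y) = c * pairDet D x y := by
  simp only [pairDet, map_smul, Pi.smul_apply, smul_eq_mul]
  ring

theorem pairDet_smul_left : pairDet D (r • x) y = r • pairDet D x y := by
  rw [← algebraMap_smul K r x, pairDet_smul_left', Algebra.smul_def]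

theorem pairDet_smul_right : pairDet D x (r • y) = r • pairDet D x y := by
  rw [← algebraMap_smul K r y, pairDet_smul_right', Algebra.smul_def]

end

/-- The `R`-module generated by the determinants of pairs of elements of `L`. -/
def detSpan (D : E →ₗ[K] (Fin 2 → K)) (L : Submodule R E) : Submodule R K :=
  Submodule.span R {z | ∃ x ∈ L, ∃ y ∈ L, z = pairDet D x y}

theorem pairDet_mem_detSpan (D : E →ₗ[K] (Fin 2 → K)) {L : Submodule R E} {x y : E}
    (hx : x ∈ L) (hy : y ∈ L) : pairDet D x y ∈ detSpan D L :=
  Submodule.subset_span ⟨x, hx, y, hy, rfl⟩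

/-- With `0 ≠ c ∈ b` and `p`, `q` corresponding to `(1, 0)` and `(0, c)`, one has `L = R p + (b / c)
q`, so `u = det(p, q) / c` works. -/
theorem detSpan_eq_of_linearEquiv (D : E →ₗ[K] (Fin 2 → K)) (L : Submodule R E)
    (hD : Set.InjOn D (Submodule.span K (L : Set E)))
    (h : Module.finrank K (Submodule.span K (L : Set E)) = 2)
    {b : Ideal R} (hb : b ≠ ⊥) (φ : L ≃ₗ[R] (R × b)) :
    ∃ u : K, u ≠ 0 ∧ detSpan D L = Submodule.span R {u} * IsLocalization.coeSubmodule K b := by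
  obtain ⟨c, hc, hc0⟩ := Submodule.exists_mem_ne_zero_of_ne_bot hb
  have hcK : algebraMap R K c ≠ 0 :=
    (map_ne_zero_iff _ (IsFractionRing.injective R K)).mpr hc0
  set p : E := ((φ.symm (1, 0) : L) : E) with hp
  set q : E := ((φ.symm (0, ⟨c, hc⟩) : L) : E) with hq
  have hpL : p ∈ L := (φ.symm (1, 0) : L).2
  have hqL : q ∈ L := (φ.symm (0, ⟨c, hc⟩) : L).2
  have expand : ∀ r : R, ∀ β : b, ((φ.symm (r, β) : L) : E) =
      algebraMap R K r • p + (algebraMap R K β / algebraMap R K c) • q := by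
    intro r β
    have h1 : (r, β) = r • ((1, 0) : R × b) + (0, β) := by ext <;> simp
    have h2 : c • ((0, β) : R × b) = (β : R) • ((0, ⟨c, hc⟩) : R × b) := by
      ext <;> simp [mul_comm]
    have h3 : c • ((φ.symm (0, β) : L) : E) = (β : R) • q := by
      rw [hq, ← Submodule.coe_smul, ← Submodule.coe_smul, ← map_smul, ← map_smul, h2]
    rw [h1, map_add, map_smul, Submodule.coe_add, Submodule.coe_smul, ← hp,
      algebraMap_smul, div_eq_inv_mul, mul_smul, algebraMap_smul, ← h3,
      ← algebraMap_smul K c, inv_smul_smul₀ hcK]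
  have hspan : Submodule.span K (L : Set E) ≤ Submodule.span K (Set.range ![p, q]) := by
    rw [Submodule.span_le]
    intro x hx
    have hx' := expand (φ ⟨x, hx⟩).1 (φ ⟨x, hx⟩).2
    rw [Prod.mk.eta, φ.symm_apply_apply] at hx'
    rw [show x = _ from hx']
    refine add_mem (Submodule.smul_mem _ _ (Submodule.subset_span ⟨0, rfl⟩))
      (Submodule.smul_mem _ _ (Submodule.subset_span ⟨1, rfl⟩))
  have hspan' : Submodule.span K (Set.range ![p, q]) ≤ Submodule.span K (L : Set E) := by
    refine Submodule.span_mono ?_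
    rintro _ ⟨i, rfl⟩
    fin_cases i
    · exact hpL
    · exact hqL
  have hli : LinearIndependent K ![p, q] := by
    rw [linearIndependent_iff_card_eq_finrank_span, Set.finrank, le_antisymm hspan' hspan, h,
      Fintype.card_fin]
  have hdet : pairDet D p q ≠ 0 := by
    have h1 := hli.map_injOn D (hD.mono hspan')
    have h2 := (Matrix.linearIndependent_rows_iff_isUnit (A := Matrix.of (D ∘ ![p, q]))).mp h1
    rw [Matrix.isUnit_iff_isUnit_det, Matrix.det_fin_two, isUnit_iff_ne_zero] at h2
    simpa [pairDet] using h2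
  refine ⟨pairDet D p q / algebraMap R K c, div_ne_zero hdet hcK, le_antisymm ?_ ?_⟩
  · rw [detSpan, Submodule.span_le]
    rintro _ ⟨x, hx, y, hy, rfl⟩
    have hx' := expand (φ ⟨x, hx⟩).1 (φ ⟨x, hx⟩).2
    have hy' := expand (φ ⟨y, hy⟩).1 (φ ⟨y, hy⟩).2
    rw [Prod.mk.eta, φ.symm_apply_apply] at hx' hy'
    generalize φ ⟨x, hx⟩ = s at hx'
    generalize φ ⟨y, hy⟩ = t at hy'
    refine Submodule.mem_span_singleton_mul.mpr ⟨algebraMap R K (s.1 * t.2 - t.1 * s.2),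
      ⟨_, sub_mem (b.mul_mem_left _ t.2.2) (b.mul_mem_left _ s.2.2), rfl⟩, ?_⟩
    rw [show x = _ from hx', show y = _ from hy']
    simp only [pairDet, map_add, map_smul, Pi.add_apply, Pi.smul_apply, smul_eq_mul, map_sub,
      map_mul]
    field_simp
    ring
  · intro z hz
    obtain ⟨_, ⟨β, hβ, rfl⟩, rfl⟩ := Submodule.mem_span_singleton_mul.mp hz
    have := pairDet_mem_detSpan D hpL (φ.symm (0, ⟨β, hβ⟩)).2
    rw [expand] at this
    convert this using 1
    simp only [pairDet, map_add, map_smul, Pi.add_apply, Pi.smul_apply, smul_eq_mul, map_zero,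
      Algebra.linearMap_apply]
    field_simp
    ring

/-- This is `f` applied to the identity `det(x, y) e + det(y, e) x + det(e, x) y = 0` between three
vectors of a plane. As `f` is only `R`-linear, a common denominator `r` of the coefficients is
cleared beforehand and cancelled afterwards. -/
theorem pairDet_relation (D : E →ₗ[K] (Fin 2 → K)) (M : Submodule R E)
    (hD : Set.InjOn D (Submodule.span K (M : Set E))) (f : M →ₗ[R] R) (x y e : M) :
    algebraMap R K (f e) * pairDet D x y + algebraMap R K (f x) * pairDet D y e +
      algebraMap R K (f y) * pairDet D e x = 0 := by
  classical
  obtain ⟨r, hr⟩ := IsLocalization.exist_integer_multiples_of_finset R⁰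
    ({pairDet D x y, pairDet D y e, pairDet D e x} : Finset K)
  obtain ⟨n₁, h₁⟩ := hr (pairDet D x y) (by simp)
  obtain ⟨n₂, h₂⟩ := hr (pairDet D y e) (by simp)
  obtain ⟨n₃, h₃⟩ := hr (pairDet D e x) (by simp)
  rw [Algebra.smul_def] at h₁ h₂ h₃
  have hr0 : algebraMap R K r ≠ 0 :=
    (map_ne_zero_iff _ (IsFractionRing.injective R K)).mpr (nonZeroDivisors.coe_ne_zero r)
  have hrel : n₁ • e + n₂ • x + n₃ • y = 0 := by
    refine Subtype.ext (hD (Submodule.subset_span (Subtype.coe_prop _))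
      (Submodule.subset_span (Subtype.coe_prop _)) ?_)
    simp only [Submodule.coe_add, Submodule.coe_smul, Submodule.coe_zero, map_add, map_zero,
      ← algebraMap_smul K n₁, ← algebraMap_smul K n₂, ← algebraMap_smul K n₃, map_smul, h₁, h₂, h₃]
    ext i
    simp only [pairDet, Pi.add_apply, Pi.smul_apply, smul_eq_mul, Pi.zero_apply]
    fin_cases i <;> simp only [Fin.zero_eta, Fin.mk_one] <;> ring
  have h := congrArg (algebraMap R K) (congrArg f hrel)
  simp only [map_add, map_smul, smul_eq_mul, map_mul, map_zero, h₁, h₂, h₃] at h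
  refine (mul_eq_zero.mp ?_).resolve_left hr0
  linear_combination h

/-- Lift `π` to `f : M → R` by projectivity and choose `e` with `π e = 1`. For `x, y ∈ L`, the
values `f x`, `f y`, `f e - 1` lie in `a`, so `pairDet_relation` puts `det(x, y)` in `a · det M`.
Conversely `M = L + R e` with `a e ⊆ L`, and determinants are expanded accordingly. -/
theorem detSpan_eq_mul_of_cyclic (D : E →ₗ[K] (Fin 2 → K)) {L M : Submodule R E}
    (hM : M.FG) (hD : Set.InjOn D (Submodule.span K (M : Set E))) {a : Ideal R} (hLM : L ≤ M)
    (π : M →ₗ[R] R ⧸ a) (hπ : Function.Surjective π) (hker : ∀ x : M, π x = 0 ↔ (x : E) ∈ L) :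
    detSpan D L = IsLocalization.coeSubmodule K a * detSpan D M := by
  have := isTorsionFree_of_isFractionRing R K E
  have hproj := projective_of_fg M hM
  have hmk : Function.Surjective (Submodule.mkQ a) := Submodule.mkQ_surjective a
  obtain ⟨f, hf⟩ := Module.projective_lifting_property (Submodule.mkQ a) π hmk
  replace hf : ∀ x, Ideal.Quotient.mk a (f x) = π x := fun x => LinearMap.congr_fun hf x
  obtain ⟨e, he⟩ := hπ 1
  have hfe : f e - 1 ∈ a := by
    rw [← Ideal.Quotient.eq, hf, he, map_one]
  have hfL : ∀ x : M, (x : E) ∈ L → f x ∈ a := fun x hx => by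
    rw [← Ideal.Quotient.eq_zero_iff_mem, hf, (hker x).mpr hx]
  have mem : ∀ {r : R} {z : K}, r ∈ a → z ∈ detSpan D M →
      algebraMap R K r * z ∈ IsLocalization.coeSubmodule K a * detSpan D M :=
    fun hr hz => Submodule.mul_mem_mul ⟨_, hr, rfl⟩ hz
  refine le_antisymm ?_ (Submodule.mul_le.mpr ?_)
  · rw [detSpan, Submodule.span_le]
    rintro _ ⟨x, hx, y, hy, rfl⟩
    have hrel := pairDet_relation D M hD f ⟨x, hLM hx⟩ ⟨y, hLM hy⟩ e
    have : pairDet D x y = -(algebraMap R K (f e - 1) * pairDet D x y) -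
        algebraMap R K (f ⟨x, hLM hx⟩) * pairDet D y e -
        algebraMap R K (f ⟨y, hLM hy⟩) * pairDet D e x := by
      rw [map_sub, map_one]
      linear_combination hrel
    rw [this]
    exact sub_mem (sub_mem (neg_mem (mem hfe (pairDet_mem_detSpan D (hLM hx) (hLM hy))))
      (mem (hfL _ hx) (pairDet_mem_detSpan D (hLM hy) e.2)))
      (mem (hfL _ hy) (pairDet_mem_detSpan D e.2 (hLM hx)))
  · rintro _ ⟨α, hα, rfl⟩ z hz
    rw [Algebra.linearMap_apply, ← Algebra.smul_def]
    have hαe : α • (e : E) ∈ L := by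
      refine (hker (α • e)).mp ?_
      rw [map_smul, he, Algebra.smul_def, mul_one]
      exact Ideal.Quotient.eq_zero_iff_mem.mpr hα
    have decomp : ∀ x ∈ M, ∃ l ∈ L, ∃ r : R, x = l + r • (e : E) := by
      intro x hx
      refine ⟨x - f ⟨x, hx⟩ • (e : E), (hker (⟨x, hx⟩ - f ⟨x, hx⟩ • e)).mp ?_, f ⟨x, hx⟩, by simp⟩
      rw [map_sub, map_smul, he, ← hf, sub_eq_zero]
      simp [Algebra.smul_def]
    induction hz using Submodule.span_induction with
    | zero => simp
    | add x y _ _ hx hy => rw [smul_add]; exact add_mem hx hy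
    | smul r x _ hx => rw [smul_comm]; exact Submodule.smul_mem _ _ hx
    | mem z hz =>
      obtain ⟨x, hx, y, hy, rfl⟩ := hz
      obtain ⟨l, hl, r, rfl⟩ := decomp x hx
      obtain ⟨m, hm, s, rfl⟩ := decomp y hy
      -- The only term in which a single `α` could not bring both arguments into `L` is `det(e, e)`,
      -- which vanishes.
      have : α • pairDet D (l + r • (e : E)) (m + s • (e : E)) =
          α • pairDet D l m + s • pairDet D l (α • (e : E)) + r • pairDet D (α • (e : E)) m := by
        simp only [pairDet_add_left, pairDet_add_right, pairDet_smul_left, pairDet_smul_right,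
          pairDet_self, smul_zero, add_zero, smul_add]
        rw [smul_comm s α, smul_comm r α]
        abel
      rw [this]
      exact add_mem (add_mem (Submodule.smul_mem _ _ (pairDet_mem_detSpan D hl hm))
        (Submodule.smul_mem _ _ (pairDet_mem_detSpan D hl hαe)))
        (Submodule.smul_mem _ _ (pairDet_mem_detSpan D hαe hm))

/-- The kernel `N` of `M → R ⧸ a₁` sits between `L` and `M` with cyclic quotients `M / N ≅ R ⧸ a₁`
and `N / L ≅ R ⧸ a₂`, so the cyclic case applies twice. -/
theorem detSpan_eq_mul_of_quotient (D : E →ₗ[K] (Fin 2 → K)) {L M : Submodule R E}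
    (hM : M.FG) (hD : Set.InjOn D (Submodule.span K (M : Set E))) (hLM : L ≤ M)
    {a₁ a₂ : Ideal R} (φ : (M ⧸ L.submoduleOf M) ≃ₗ[R] ((R ⧸ a₁) × (R ⧸ a₂))) :
    detSpan D L = IsLocalization.coeSubmodule K (a₁ * a₂) * detSpan D M := by
  let Φ : M →ₗ[R] ((R ⧸ a₁) × (R ⧸ a₂)) := φ.toLinearMap ∘ₗ (L.submoduleOf M).mkQ
  have hΦ : Function.Surjective Φ := φ.surjective.comp (Submodule.mkQ_surjective _)
  have hΦ0 : ∀ x : M, Φ x = 0 ↔ (x : E) ∈ L := by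
    intro x
    rw [LinearMap.comp_apply, LinearEquiv.coe_coe, LinearEquiv.map_eq_zero_iff,
      Submodule.mkQ_apply, Submodule.Quotient.mk_eq_zero]
    rfl
  let π₁ : M →ₗ[R] R ⧸ a₁ := LinearMap.fst R _ _ ∘ₗ Φ
  let N : Submodule R E := (LinearMap.ker π₁).map M.subtype
  have hNM : N ≤ M := Submodule.map_subtype_le _ _
  have hmemN : ∀ x : M, (x : E) ∈ N ↔ (Φ x).1 = 0 := by
    intro x
    simp [N, π₁]
  let π₂ : N →ₗ[R] R ⧸ a₂ := LinearMap.snd R _ _ ∘ₗ Φ ∘ₗ Submodule.inclusion hNM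
  have hN : N.FG := by
    have : Module.Finite R M := Module.Finite.iff_fg.mpr hM
    exact (IsNoetherian.noetherian (LinearMap.ker π₁)).map _
  have hLN : L ≤ N := fun x hx => (hmemN ⟨x, hLM hx⟩).mpr (by rw [(hΦ0 _).mpr hx]; rfl)
  rw [detSpan_eq_mul_of_cyclic D hN (hD.mono (Submodule.span_mono hNM)) hLN π₂ ?_ ?_,
    detSpan_eq_mul_of_cyclic D hM hD hNM π₁ ?_ ?_, ← mul_assoc, IsLocalization.coeSubmodule_mul,
    mul_comm (IsLocalization.coeSubmodule K a₁)]
  · exact fun z => (hΦ (z, 0)).imp fun x hx => congrArg Prod.fst hx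
  · exact fun x => (hmemN x).symm
  · intro z
    obtain ⟨x, hx⟩ := hΦ (0, z)
    exact ⟨⟨x, (hmemN x).mpr (by rw [hx])⟩, congrArg Prod.snd hx⟩
  · intro x
    rw [← hΦ0 ⟨x, hNM x.2⟩, Prod.ext_iff]
    exact ⟨fun h => ⟨(hmemN ⟨x, hNM x.2⟩).mp x.2, h⟩, fun h => h.2⟩

theorem mk0_eq_mk_mul_mk0 {b b' : (Ideal R)⁰} {u u' : K} (hu : u ≠ 0) (hu' : u' ≠ 0)
    (I : (FractionalIdeal R⁰ K)ˣ)
    (h : Submodule.span R {u} * IsLocalization.coeSubmodule K (b : Ideal R) =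
      ((I : FractionalIdeal R⁰ K) : Submodule R K) *
        (Submodule.span R {u'} * IsLocalization.coeSubmodule K (b' : Ideal R))) :
    ClassGroup.mk0 b = ClassGroup.mk K I * ClassGroup.mk0 b' := by
  have hprinc : ∀ x : Kˣ, ClassGroup.mk K (toPrincipalIdeal R K x) = 1 := by
    intro x
    rw [ClassGroup.mk_eq_one_iff]
    exact ⟨⟨x, by simp⟩⟩
  have key : toPrincipalIdeal R K (Units.mk0 u hu) * FractionalIdeal.mk0 K b =
      I * (toPrincipalIdeal R K (Units.mk0 u' hu') * FractionalIdeal.mk0 K b') := by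
    refine Units.ext (FractionalIdeal.coeToSubmodule_injective ?_)
    simpa [FractionalIdeal.coe_mul] using h
  have := congrArg (ClassGroup.mk K) key
  simpa only [map_mul, hprinc, one_mul, ClassGroup.mk_mk0] using this

end Dedekind

/-! ### Steinitz classes of lattices -/

section Steinitz

variable {K : Type*} [Field K] [NumberField K]

/-- Existence is all that is needed here: classes are later compared through determinants, which
works for whichever witness was chosen. -/
theorem IsLattice.hasSteinitzClass {L : Submodule (𝓞 K) (KHatSq K)} (hL : IsLattice L) :
    HasSteinitzClass L (steinitzClass L) := by
  have h : ∃ c, HasSteinitzClass L c := by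
    obtain ⟨b, hb, ⟨e⟩⟩ := exists_linearEquiv_prod_ideal (K := K) L hL.fg hL.finrank_span
    exact ⟨_, ⟨b, mem_nonZeroDivisors_of_ne_zero hb⟩, rfl, ⟨e⟩⟩
  rw [steinitzClass, dif_pos h]
  exact h.choose_spec

/-- The Steinitz class is determined by the fractional ideal of determinants. -/
theorem steinitzClass_eq_mk_mul {L M : Submodule (𝓞 K) (KHatSq K)} (hL : IsLattice L)
    (hM : IsLattice M) (D : KHatSq K →ₗ[K] (Fin 2 → K))
    (hDL : Set.InjOn D (Submodule.span K (L : Set (KHatSq K))))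
    (hDM : Set.InjOn D (Submodule.span K (M : Set (KHatSq K))))
    (I : (FractionalIdeal (𝓞 K)⁰ K)ˣ)
    (h : detSpan D L = ((I : FractionalIdeal (𝓞 K)⁰ K) : Submodule (𝓞 K) K) * detSpan D M) :
    steinitzClass L = ClassGroup.mk K I * steinitzClass M := by
  obtain ⟨b, hb, ⟨e⟩⟩ := hL.hasSteinitzClass
  obtain ⟨b', hb', ⟨e'⟩⟩ := hM.hasSteinitzClass
  obtain ⟨u, hu, hLu⟩ := detSpan_eq_of_linearEquiv D L hDL hL.finrank_span
    (nonZeroDivisors.coe_ne_zero b) e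
  obtain ⟨u', hu', hMu⟩ := detSpan_eq_of_linearEquiv D M hDM hM.finrank_span
    (nonZeroDivisors.coe_ne_zero b') e'
  rw [← hb, ← hb']
  rw [hLu, hMu] at h
  exact mk0_eq_mk_mul_mk0 hu hu' I h

theorem latticeClass_of_hasIndexIdeal {L M : Submodule (𝓞 K) (KHatSq K)} (hL : IsLattice L)
    (hM : IsLattice M) {a : (Ideal (𝓞 K))⁰} (h : HasIndexIdeal L M a) :
    latticeClass M = ClassGroup.mk0 a * latticeClass L := by
  obtain ⟨hLM, a₁, a₂, -, ha, ⟨φ⟩⟩ := h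
  obtain ⟨D, hD, -⟩ := exists_coordinates (K := K) M hM.finrank_span
  have key := detSpan_eq_mul_of_quotient D hM.fg hD hLM φ
  rw [ha] at key
  have := steinitzClass_eq_mk_mul hL hM D (hD.mono (Submodule.span_mono hLM)) hD
    (FractionalIdeal.mk0 K a) (by
      rw [key, FractionalIdeal.coe_mk0, FractionalIdeal.coe_coeIdeal])
  rw [latticeClass, latticeClass, this, ClassGroup.mk_mk0, mul_inv, mul_inv_cancel_left]

/-- By bilinearity each of the two arguments contributes a factor `I`. -/
theorem detSpan_fracSMul (D : KHatSq K →ₗ[K] (Fin 2 → K)) (I : FractionalIdeal (𝓞 K)⁰ K)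
    (L : Submodule (𝓞 K) (KHatSq K)) :
    detSpan D (fracSMul I L) = ((I * I : FractionalIdeal (𝓞 K)⁰ K) : Submodule (𝓞 K) K) *
      detSpan D L := by
  rw [FractionalIdeal.coe_mul]
  refine le_antisymm ?_ (Submodule.mul_le.mpr fun c hc z hz => ?_)
  · rw [detSpan, Submodule.span_le]
    rintro _ ⟨x, hx, y, hy, rfl⟩
    rw [SetLike.mem_coe]
    induction hx using Submodule.span_induction with
    | zero => rw [pairDet_zero_left]; exact zero_mem _
    | add x x' _ _ h h' => rw [pairDet_add_left]; exact add_mem h h'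
    | smul r x _ h => rw [pairDet_smul_left]; exact Submodule.smul_mem _ _ h
    | mem x hx =>
      obtain ⟨α, hα, x, hx, rfl⟩ := hx
      induction hy using Submodule.span_induction with
      | zero => rw [pairDet_zero_right]; exact zero_mem _
      | add y y' _ _ h h' => rw [pairDet_add_right]; exact add_mem h h'
      | smul r y _ h => rw [pairDet_smul_right]; exact Submodule.smul_mem _ _ h
      | mem y hy =>
        obtain ⟨β, hβ, y, hy, rfl⟩ := hy
        rw [pairDet_smul_left', pairDet_smul_right', ← mul_assoc]
        exact Submodule.mul_mem_mul (Submodule.mul_mem_mul hα hβ) (pairDet_mem_detSpan D hx hy)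
  · have hmem : ∀ {α : K} {x : KHatSq K}, α ∈ I → x ∈ L → α • x ∈ fracSMul I L :=
      fun hα hx => Submodule.subset_span ⟨_, hα, _, hx, rfl⟩
    induction hz using Submodule.span_induction with
    | zero => rw [mul_zero]; exact zero_mem _
    | add x y _ _ hx hy => rw [mul_add]; exact add_mem hx hy
    | smul r x _ hx => rw [mul_smul_comm]; exact Submodule.smul_mem _ _ hx
    | mem z hz =>
      obtain ⟨x, hx, y, hy, rfl⟩ := hz
      induction hc using Submodule.mul_induction_on' with
      | add c _ d _ hc hd => rw [add_mul]; exact add_mem hc hd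
      | mem_mul_mem α hα β hβ =>
        rw [mul_assoc, ← pairDet_smul_right', ← pairDet_smul_left']
        exact pairDet_mem_detSpan D (hmem hα hx) (hmem hβ hy)

theorem fracSMul_le_span (I : FractionalIdeal (𝓞 K)⁰ K) (L : Submodule (𝓞 K) (KHatSq K)) :
    Submodule.span K (fracSMul I L : Set (KHatSq K)) ≤
      Submodule.span K (L : Set (KHatSq K)) := by
  refine Submodule.span_le.mpr fun x hx => ?_
  refine (Submodule.span_le (p := (Submodule.span K (L : Set (KHatSq K))).restrictScalars
    (𝓞 K))).mpr ?_ hx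
  rintro _ ⟨a, -, x, hx, rfl⟩
  exact Submodule.smul_mem _ a (Submodule.subset_span hx)

theorem latticeClass_fracSMul_inv {L : Submodule (𝓞 K) (KHatSq K)} (hL : IsLattice L)
    (a : (FractionalIdeal (𝓞 K)⁰ K)ˣ)
    (hM : IsLattice (fracSMul (a⁻¹ : (FractionalIdeal (𝓞 K)⁰ K)ˣ) L)) :
    latticeClass (fracSMul (a⁻¹ : (FractionalIdeal (𝓞 K)⁰ K)ˣ) L) =
      ClassGroup.mk (R := 𝓞 K) (K := K) a ^ 2 * latticeClass L := by
  obtain ⟨D, hD, -⟩ := exists_coordinates (K := K) L hL.finrank_span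
  have := steinitzClass_eq_mk_mul hM hL D (hD.mono (fracSMul_le_span _ _)) hD (a⁻¹ * a⁻¹) (by
    rw [detSpan_fracSMul, Units.val_mul])
  rw [latticeClass, latticeClass, this, map_mul, map_inv, mul_inv, mul_inv, inv_inv, pow_two]

end Steinitz

/-! ### Effect of the Hecke relations on classes of modular points -/

section Degree

variable {K : Type*} [Field K] [NumberField K] {n : Ideal (𝓞 K)}

theorem RelT.cls_eq {a : (Ideal (𝓞 K))⁰} :
    ∀ {k : LevelKind} {P Q : ModularPoint K k n}, RelT a k P Q →
      Q.cls = ClassGroup.mk0 a * P.cls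
  | .gamma0, P, Q, h => latticeClass_of_hasIndexIdeal P.base.isLattice Q.base.isLattice h.1
  | .gamma1, P, Q, h => latticeClass_of_hasIndexIdeal P.base.isLattice Q.base.isLattice h.1

theorem RelTT.cls_eq {a : (FractionalIdeal (𝓞 K)⁰ K)ˣ} :
    ∀ {k : LevelKind} {P Q : ModularPoint K k n}, RelTT a k P Q →
      Q.cls = ClassGroup.mk (R := 𝓞 K) (K := K) a ^ 2 * P.cls := by
  have key : ∀ P Q : ModularPoint₀ K n,
      Q.L = fracSMul (a⁻¹ : (FractionalIdeal (𝓞 K)⁰ K)ˣ) P.L →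
      latticeClass Q.L = ClassGroup.mk (R := 𝓞 K) (K := K) a ^ 2 * latticeClass P.L := by
    intro P Q h
    have hQ := Q.isLattice
    rw [h] at hQ ⊢
    exact latticeClass_fracSMul_inv P.isLattice a hQ
  intro k P Q h
  cases k
  · exact key _ _ h.1
  · exact key _ _ h.1

end Degree

/-! ### Degrees relative to a family of idempotents -/

section Idempotents

variable {A G : Type*} [Ring A] [CommGroup G] [Fintype G]

/-- The component of degree `c` of a ring element, with respect to a family of idempotents indexed
by `G`. -/
def degreePart (e : G → A) (c : G) : A →+ A where
  toFun T := ∑ g, e (c * g) * T * e g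
  map_zero' := by simp
  map_add' S T := by simp only [mul_add, add_mul, Finset.sum_add_distrib]

theorem degreePart_apply (e : G → A) (c : G) (T : A) :
    degreePart e c T = ∑ g, e (c * g) * T * e g := rfl

/-- A ring element of degree `c`, with respect to a family of idempotents indexed by `G`. -/
def HasDegree (e : G → A) (c : G) (T : A) : Prop := ∀ g, e (c * g) * T * e g = T * e g

variable {e : G → A}

theorem HasDegree.degreePart_self (he : CompleteOrthogonalIdempotents e) {c : G} {T : A}
    (h : HasDegree e c T) : degreePart e c T = T := by
  rw [degreePart_apply, Finset.sum_congr rfl fun g _ => h g, ← Finset.mul_sum, he.complete, mul_one]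

theorem HasDegree.degreePart_of_ne (he : CompleteOrthogonalIdempotents e) {c d : G} {T : A}
    (h : HasDegree e c T) (hd : d ≠ c) : degreePart e d T = 0 := by
  refine Finset.sum_eq_zero fun g _ => ?_
  rw [mul_assoc, ← h g, mul_assoc (e (c * g)), ← mul_assoc,
    he.ortho (fun h => hd (mul_right_cancel h)), zero_mul]

/-- Insert `1 = ∑ e (d * g)` between `S` and `T` in `e (c * g) * S * T * e g`: the `d`-th term
combines the part of `T` of degree `d` with that of `S` of degree `c * d⁻¹`. -/
theorem degreePart_mul (he : CompleteOrthogonalIdempotents e) (c : G) (S T : A) :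
    degreePart e c (S * T) = ∑ d, degreePart e (c * d⁻¹) S * degreePart e d T := by
  classical
  have hterm : ∀ d, degreePart e (c * d⁻¹) S * degreePart e d T =
      ∑ g, e (c * g) * S * e (d * g) * T * e g := by
    intro d
    rw [degreePart_apply e d T, Finset.mul_sum]
    refine Finset.sum_congr rfl fun g _ => ?_
    rw [degreePart_apply, Finset.sum_mul, Finset.sum_eq_single (d * g)]
    · rw [← mul_assoc (c * d⁻¹), inv_mul_cancel_right]
      calc _ = e (c * g) * S * (e (d * g) * e (d * g)) * T * e g := by simp only [mul_assoc]
        _ = _ := by rw [(he.idem _).eq]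
    · intro h _ hh
      calc _ = e (c * d⁻¹ * h) * S * (e h * e (d * g)) * T * e g := by simp only [mul_assoc]
        _ = 0 := by rw [he.ortho hh]; simp
    · exact fun h => absurd (Finset.mem_univ _) h
  rw [Finset.sum_congr rfl fun d _ => hterm d, Finset.sum_comm, degreePart_apply]
  refine Finset.sum_congr rfl fun g _ => ?_
  have hsum : ∑ d, e (d * g) = 1 :=
    (Fintype.sum_equiv (Equiv.mulRight g) _ _ fun d => rfl).trans he.complete
  calc _ = e (c * g) * S * (∑ d, e (d * g)) * T * e g := by rw [hsum, mul_one, ← mul_assoc]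
    _ = _ := by simp only [Finset.mul_sum, Finset.sum_mul]

variable [Algebra ℚ A]

theorem hasDegree_one_algebraMap (he : CompleteOrthogonalIdempotents e) (r : ℚ) :
    HasDegree e 1 (algebraMap ℚ A r) := by
  intro g
  rw [one_mul, ← Algebra.commutes, mul_assoc, (he.idem g).eq]

/-- The idempotents need not lie in the subalgebra, so this rests on the homogeneity of the
generators; products are handled by `degreePart_mul`. -/
theorem degreePart_mem_adjoin (he : CompleteOrthogonalIdempotents e) {s : Set A}
    (hs : ∀ T ∈ s, ∃ c, HasDegree e c T) {T : A} (hT : T ∈ Algebra.adjoin ℚ s) :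
    ∀ c, degreePart e c T ∈ Algebra.adjoin ℚ s := by
  classical
  have homog : ∀ {c : G} {T : A}, T ∈ Algebra.adjoin ℚ s → HasDegree e c T →
      ∀ d, degreePart e d T ∈ Algebra.adjoin ℚ s := by
    intro c T hT h d
    by_cases hd : d = c
    · rw [hd, h.degreePart_self he]
      exact hT
    · rw [h.degreePart_of_ne he hd]
      exact zero_mem _
  induction hT using Algebra.adjoin_induction with
  | mem T hT =>
    obtain ⟨c, hc⟩ := hs T hT
    exact homog (Algebra.subset_adjoin hT) hc
  | algebraMap r => exact homog (Subalgebra.algebraMap_mem _ r) (hasDegree_one_algebraMap he r)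
  | add S T _ _ hS hT =>
    intro c
    rw [map_add]
    exact add_mem (hS c) (hT c)
  | mul S T _ _ hS hT =>
    intro c
    rw [degreePart_mul he]
    exact sum_mem fun d _ => mul_mem (hS _) (hT _)

/-- The twist of a character of an algebra generated by homogeneous elements by a character of the
group of degrees. -/
theorem exists_twist (he : CompleteOrthogonalIdempotents e) {s : Set A}
    (hs : ∀ T ∈ s, ∃ c, HasDegree e c T) (ψ : G →* ℂˣ) (lam : Algebra.adjoin ℚ s →+* ℂ) :
    ∃ lam' : Algebra.adjoin ℚ s →+* ℂ, ∀ (c : G) (T : Algebra.adjoin ℚ s),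
      HasDegree e c (T : A) → lam' T = lam T * (ψ c : ℂ) := by
  classical
  let part (c : G) : Algebra.adjoin ℚ s →+ Algebra.adjoin ℚ s :=
    { toFun := fun T => ⟨degreePart e c T, degreePart_mem_adjoin he hs T.2 c⟩
      map_zero' := Subtype.ext (map_zero (degreePart e c))
      map_add' := fun S T => Subtype.ext (map_add (degreePart e c) _ _) }
  -- The twist weights the component of degree `c` by `ψ c`.
  let tw : Algebra.adjoin ℚ s →+ ℂ :=
    { toFun := fun T => ∑ c, lam (part c T) * (ψ c : ℂ)
      map_zero' := by simp
      map_add' := fun S T => by simp only [map_add, add_mul, Finset.sum_add_distrib] }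
  have htw : ∀ T, tw T = ∑ c, lam (part c T) * (ψ c : ℂ) := fun _ => rfl
  have part_mul : ∀ c S T, part c (S * T) = ∑ d, part (c * d⁻¹) S * part d T := by
    intro c S T
    refine Subtype.ext ((degreePart_mul he c S T).trans ?_)
    rw [AddSubmonoidClass.coe_finsetSum]
    rfl
  have homog : ∀ (c : G) (T : Algebra.adjoin ℚ s), HasDegree e c (T : A) →
      tw T = lam T * (ψ c : ℂ) := by
    intro c T h
    rw [htw, Finset.sum_eq_single c]
    · rw [show part c T = T from Subtype.ext (h.degreePart_self he)]
    · intro d _ hd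
      rw [show part d T = 0 from Subtype.ext (h.degreePart_of_ne he hd), map_zero, zero_mul]
    · exact fun h => absurd (Finset.mem_univ _) h
  refine ⟨{ tw with map_one' := ?_, map_mul' := ?_ }, homog⟩
  · have := homog 1 1 (by simpa using hasDegree_one_algebraMap he 1)
    rwa [map_one lam, map_one ψ, Units.val_one, one_mul] at this
  · intro S T
    change tw (S * T) = tw S * tw T
    simp only [htw, part_mul, map_sum, Finset.sum_mul, map_mul]
    rw [Finset.sum_comm, ← Finset.sum_mul, Finset.mul_sum]
    refine Finset.sum_congr rfl fun d _ => ?_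
    -- For fixed `d`, substituting `c * d` for `c` turns the component of `S` of degree `c * d⁻¹`
    -- into that of degree `c`, and `ψ (c * d)` factors.
    rw [Finset.sum_mul, ← Fintype.sum_equiv (Equiv.mulRight d)
      (fun c => lam (part c S) * (ψ c : ℂ) * (lam (part d T) * (ψ d : ℂ))) _ fun c => ?_]
    simp only [Equiv.coe_mulRight, mul_inv_cancel_right, map_mul, Units.val_mul]
    ring

end Idempotents

/-! ### Operators on formal linear combinations -/

section Operators

variable {X G : Type*}

open Classical in
/-- The projection onto the span of the elements of class `g`. -/
def classProj (cl : X → G) (g : G) : Module.End ℚ (X →₀ ℚ) where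
  toFun v := v.filter fun P => cl P = g
  map_add' _ _ := Finsupp.filter_add
  map_smul' _ _ := Finsupp.filter_smul

open Classical in
theorem classProj_apply (cl : X → G) (g : G) (v : X →₀ ℚ) (P : X) :
    classProj cl g v P = if cl P = g then v P else 0 :=
  Finsupp.filter_apply _ _ _

theorem classProj_eq_self {cl : X → G} {g : G} {v : X →₀ ℚ}
    (hv : v ∈ Finsupp.supported ℚ ℚ {P | cl P = g}) : classProj cl g v = v := by
  ext P
  rw [classProj_apply]
  split_ifs with h
  · rfl
  · exact ((Finsupp.mem_supported' _ _).mp hv P h).symm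

theorem classProj_completeOrthogonalIdempotents [Fintype G] (cl : X → G) :
    CompleteOrthogonalIdempotents (classProj cl) := by
  classical
  rw [CompleteOrthogonalIdempotents.iff_ortho_complete]
  constructor
  · intro g h hgh
    refine LinearMap.ext fun v => Finsupp.ext fun P => ?_
    rw [Module.End.mul_apply, classProj_apply, classProj_apply]
    split_ifs with h1 h2
    · exact absurd (h1.symm.trans h2) hgh
    · rfl
    · rfl
  · refine LinearMap.ext fun v => Finsupp.ext fun P => ?_
    rw [LinearMap.sum_apply, Finsupp.finsetSum_apply]
    simp only [classProj_apply, Module.End.one_apply]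
    exact Fintype.sum_ite_eq (cl P) fun _ => v P

/-- No finiteness of the sum is required: the default value `0` of an infinite `finsum` is supported
on `s` as well. -/
theorem relOperator_single_mem_supported {R : X → X → Prop} {s : Set X} {P : X} (q : ℚ)
    (h : ∀ Q, R P Q → Q ∈ s) :
    relOperator q R (Finsupp.single P 1) ∈ Finsupp.supported ℚ ℚ s := by
  rw [relOperator, Finsupp.linearCombination_single, one_smul]
  refine Submodule.smul_mem _ _ ?_
  refine finsum_induction (p := (· ∈ Finsupp.supported ℚ ℚ s)) (zero_mem _)
    (fun _ _ => add_mem) fun Q => ?_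
  exact finsum_induction (p := (· ∈ Finsupp.supported ℚ ℚ s)) (zero_mem _)
    (fun _ _ => add_mem) fun hQ => Finsupp.single_mem_supported ℚ 1 (h Q hQ)

theorem hasDegree_classProj [CommGroup G] [Fintype G] {cl : X → G} {c : G}
    {T : Module.End ℚ (X →₀ ℚ)}
    (h : ∀ P, T (Finsupp.single P 1) ∈ Finsupp.supported ℚ ℚ {Q | cl Q = c * cl P}) :
    HasDegree (classProj cl) c T := by
  classical
  intro g
  refine Finsupp.lhom_ext' fun P => LinearMap.ext_ring ?_
  simp only [LinearMap.comp_apply, Finsupp.lsingle_apply, Module.End.mul_apply]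
  by_cases hP : cl P = g
  · have h1 : classProj cl g (Finsupp.single P 1) = Finsupp.single P 1 :=
      classProj_eq_self (Finsupp.single_mem_supported ℚ 1 hP)
    rw [h1, classProj_eq_self (hP ▸ h P)]
  · have h1 : classProj cl g (Finsupp.single P 1) = 0 := Finsupp.filter_single_of_neg _ hP
    rw [h1, map_zero, map_zero]

theorem complexify_mem_supported {T : Module.End ℚ (X →₀ ℚ)} {s t : Set X}
    (h : ∀ P ∈ s, T (Finsupp.single P 1) ∈ Finsupp.supported ℚ ℚ t) {v : X →₀ ℂ}
    (hv : v ∈ Finsupp.supported ℂ ℂ s) : complexify X T v ∈ Finsupp.supported ℂ ℂ t := by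
  refine Submodule.sum_mem _ fun P hP => Submodule.smul_mem _ _ ?_
  have hPs : P ∈ s := (Finsupp.mem_supported _ _).mp hv (hP)
  rw [Finsupp.mem_supported']
  intro Q hQ
  rw [Finsupp.mapRange_apply, (Finsupp.mem_supported' _ _).mp (h P hPs) Q hQ, map_zero]

end Operators

/-! ### The Hecke algebra -/

section HeckeAlgebra

variable {K : Type*} [Field K] [NumberField K] {k : LevelKind} {n : Ideal (𝓞 K)}

theorem opT_single_mem_supported (a : (Ideal (𝓞 K))⁰) (P : ModularPoint K k n) :
    opT k n a (Finsupp.single P 1) ∈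
      Finsupp.supported ℚ ℚ {Q | Q.cls = ClassGroup.mk0 a * P.cls} :=
  relOperator_single_mem_supported _ fun _ => RelT.cls_eq

theorem opTT_single_mem_supported (a : coprimeIdeals K n) (P : ModularPoint K k n) :
    opTT k n a (Finsupp.single P 1) ∈
      Finsupp.supported ℚ ℚ {Q | Q.cls = ClassGroup.mk (R := 𝓞 K) (K := K) a.1 ^ 2 * P.cls} :=
  relOperator_single_mem_supported _ fun _ => RelTT.cls_eq

theorem isGradedAction_complexPart :
    IsGradedAction (complexAction K k n) (complexPart K k n) where
  indep := by
    rw [iSupIndep_iff_finsetSum_eq_zero_imp_eq_zero]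
    intro s v hv hsum c hc
    ext P
    by_cases hP : P.cls = c
    -- At a point `P` of class `c` only the summand of index `c` can have a nonzero coefficient.
    · have h := DFunLike.congr_fun hsum P
      rw [Finsupp.finsetSum_apply, Finset.sum_eq_single_of_mem c hc] at h
      · exact h
      · exact fun d hd hdc => (Finsupp.mem_supported' _ _).mp (hv d hd) P
          fun hPd => hdc (hPd.symm.trans hP)
    · exact (Finsupp.mem_supported' _ _).mp (hv c hc) P hP
  iSup_eq_top := by
    simp only [complexPart]
    rw [← Finsupp.supported_iUnion, ← Finsupp.supported_univ]
    congr 1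
    ext P
    simp
  map_T a c v hv := complexify_mem_supported
    (fun P hP => (show P.cls = c from hP) ▸ opT_single_mem_supported a P) hv
  map_TT a c v hv := complexify_mem_supported
    (fun P hP => (show P.cls = c from hP) ▸ opTT_single_mem_supported a P) hv

theorem sum_component (v : ModularPoint K k n →₀ ℂ) : ∑ c, component c v = v := by
  classical
  ext P
  rw [Finsupp.finsetSum_apply]
  simp [component, Finsupp.filter_apply]

theorem component_mem (c : ClassGroup (𝓞 K)) (v : ModularPoint K k n →₀ ℂ) :
    component c v ∈ complexPart K k n c := by
  classical
  rw [complexPart, Finsupp.mem_supported']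
  exact fun P hP => Finsupp.filter_apply_neg _ _ hP

/-- Induction on elements of the Hecke algebra. -/
theorem heckeAlgebra_induction {p : heckeAlgebra K k n → Prop} (hT : ∀ a, p (heckeT k n a))
    (hTT : ∀ a, p (heckeTT k n a)) (hr : ∀ r : ℚ, p (algebraMap ℚ _ r))
    (hadd : ∀ S T, p S → p T → p (S + T)) (hmul : ∀ S T, p S → p T → p (S * T))
    (T : heckeAlgebra K k n) : p T := by
  obtain ⟨T, hT'⟩ := T
  induction hT' using Algebra.adjoin_induction with
  | mem T h =>
    obtain ⟨a, rfl⟩ | ⟨a, rfl⟩ := h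
    · exact hT a
    · exact hTT a
  | algebraMap r => exact hr r
  | add S T _ _ hS hT => exact hadd _ _ hS hT
  | mul S T _ _ hS hT => exact hmul _ _ hS hT

theorem exists_isTwist (ψ : ClassGroup (𝓞 K) →* ℂˣ) (lam : heckeAlgebra K k n →+* ℂ) :
    ∃ lam', IsTwist ψ lam lam' := by
  have hdT : ∀ a, HasDegree (classProj ModularPoint.cls) (ClassGroup.mk0 a) (opT k n a) :=
    fun a => hasDegree_classProj (opT_single_mem_supported a)
  have hdTT : ∀ a : coprimeIdeals K n, HasDegree (classProj ModularPoint.cls)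
      (ClassGroup.mk (R := 𝓞 K) (K := K) a.1 ^ 2) (opTT k n a) :=
    fun a => hasDegree_classProj (opTT_single_mem_supported a)
  obtain ⟨lam', h⟩ := exists_twist
    (classProj_completeOrthogonalIdempotents (ModularPoint.cls (K := K) (k := k) (n := n)))
    (s := Set.range (opT k n) ∪ Set.range (opTT k n)) (by
      rintro _ (⟨a, rfl⟩ | ⟨a, rfl⟩)
      · exact ⟨_, hdT a⟩
      · exact ⟨_, hdTT a⟩) ψ lam
  refine ⟨lam', fun a => h _ (heckeT k n a) (hdT a), fun a => ?_⟩
  rw [← Units.val_pow_eq_pow_val, ← map_pow]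
  exact h _ (heckeTT k n a) (hdTT a)

theorem IsTwist.unique {ψ : ClassGroup (𝓞 K) →* ℂˣ} {lam μ ν : heckeAlgebra K k n →+* ℂ}
    (hμ : IsTwist ψ lam μ) (hν : IsTwist ψ lam ν) : μ = ν := by
  refine RingHom.ext (heckeAlgebra_induction (fun a => ?_) (fun a => ?_) (fun r => ?_)
    (fun S T hS hT => ?_) fun S T hS hT => ?_)
  · rw [hμ.apply_T, hν.apply_T]
  · rw [hμ.apply_TT, hν.apply_TT]
  -- Eigensystems are only assumed to be ring homomorphisms, but a ring homomorphism `ℚ → ℂ` is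
  -- unique.
  · exact RingHom.congr_fun (Subsingleton.elim (μ.comp (algebraMap ℚ _))
      (ν.comp (algebraMap ℚ _))) r
  · rw [map_add, map_add, hS, hT]
  · rw [map_mul, map_mul, hS, hT]

/-! ### Twists of eigenvectors in graded modules -/

section Eigenvector

variable {V : Type*} [AddCommGroup V] [Module ℂ V]

/-- An operator of degree `d` which multiplies `∑ u_c` by `z` multiplies its twist by
`z ψ(d)`. -/
theorem apply_twist_eq {G : Type*} [CommGroup G] [Fintype G] {W : G → Submodule ℂ V}
    (hW : iSupIndep W) (ψ : G →* ℂˣ) {T : Module.End ℂ V} {d : G} {z : ℂ}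
    (hT : ∀ c, ∀ v ∈ W c, T v ∈ W (d * c)) {u : G → V} (hu : ∀ c, u c ∈ W c)
    (h : T (∑ c, u c) = z • ∑ c, u c) :
    T (∑ c, ((ψ⁻¹ c : ℂˣ) : ℂ) • u c) =
      (z * (ψ d : ℂ)) • ∑ c, ((ψ⁻¹ c : ℂˣ) : ℂ) • u c := by
  have shift : ∀ f : G → V, ∑ c, f c = ∑ c, f (d * c) :=
    fun f => (Fintype.sum_equiv (Equiv.mulLeft d) _ _ fun c => rfl).symm
  have hcomp : ∀ c, T (u c) = z • u (d * c) := by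
    rw [map_sum, Finset.smul_sum, shift fun c => z • u c] at h
    rw [iSupIndep_iff_finsetSum_eq_imp_eq] at hW
    -- The component of `T (∑ u c)` in `W c` is the image of the component of degree `d⁻¹ * c`;
    -- independence allows comparison degree by degree.
    have := hW Finset.univ (fun c => T (u (d⁻¹ * c))) (fun c => z • u c) (fun c _ => ⟨by
      have := hT _ _ (hu (d⁻¹ * c))
      rwa [mul_inv_cancel_left] at this, Submodule.smul_mem _ _ (hu c)⟩) (by
      rw [shift, shift fun c => z • u c]
      simpa only [inv_mul_cancel_left] using h)
    intro c
    simpa only [inv_mul_cancel_left] using this (d * c) (Finset.mem_univ _)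
  rw [map_sum, shift fun c => ((ψ⁻¹ c : ℂˣ) : ℂ) • u c, Finset.smul_sum]
  refine Finset.sum_congr rfl fun c _ => ?_
  rw [map_smul, hcomp, smul_smul, smul_smul, map_mul, Units.val_mul, MonoidHom.inv_apply ψ d,
    mul_assoc z, ← mul_assoc (ψ d : ℂ), Units.mul_inv, one_mul, mul_comm z]

/-- The twisted vector is nonzero because the `W c` are independent and the values of `ψ⁻¹` are
units. `apply_twist_eq` needs a homogeneous operator, so it is applied to the generators only, and
the eigenvector equation then extends to the whole algebra. -/
theorem IsEigenvector.twist {ψ : ClassGroup (𝓞 K) →* ℂˣ} {lam lam' : heckeAlgebra K k n →+* ℂ}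
    (hlam : IsTwist ψ lam lam') {ρ : heckeAlgebra K k n →+* Module.End ℂ V}
    {W : ClassGroup (𝓞 K) → Submodule ℂ V} (hW : IsGradedAction ρ W)
    {u : ClassGroup (𝓞 K) → V} (hu : ∀ c, u c ∈ W c) (h : IsEigenvector ρ lam (∑ c, u c)) :
    IsEigenvector ρ lam' (∑ c, ((ψ⁻¹ c : ℂˣ) : ℂ) • u c) := by
  refine ⟨fun h0 => h.1 (Finset.sum_eq_zero fun c hc => ?_),
    heckeAlgebra_induction (fun a => ?_) (fun a => ?_) (fun r => ?_) (fun S T hS hT => ?_)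
    fun S T hS hT => ?_⟩
  · have := (iSupIndep_iff_finsetSum_eq_zero_imp_eq_zero W).mp hW.indep Finset.univ _
      (fun c _ => Submodule.smul_mem _ _ (hu c)) h0 c hc
    exact (smul_eq_zero.mp this).resolve_left (Units.ne_zero _)
  · rw [hlam.apply_T]
    exact apply_twist_eq hW.indep ψ (hW.map_T a) hu (h.2 _)
  · rw [hlam.apply_TT, ← Units.val_pow_eq_pow_val, ← map_pow]
    exact apply_twist_eq hW.indep ψ (hW.map_TT a) hu (h.2 _)
  · have h1 := Subsingleton.elim (ρ.comp (algebraMap ℚ _))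
      ((algebraMap ℂ (Module.End ℂ V)).comp (lam'.comp (algebraMap ℚ _)))
    have h2 := RingHom.congr_fun h1 r
    simp only [RingHom.comp_apply] at h2
    rw [h2, Module.algebraMap_end_apply]
  · rw [map_add, map_add, LinearMap.add_apply, hS, hT, add_smul]
  · rw [map_mul, map_mul, Module.End.mul_apply, hT, map_smul, hS, smul_smul, mul_comm]

end Eigenvector

end HeckeAlgebra

end Hecke

end

theorem mainTheorem8 {K : Type*} [Field K] [NumberField K] (k : Hecke.LevelKind)
    (n : Ideal (𝓞 K)) (hn : n ≠ ⊥) (ψ : ClassGroup (𝓞 K) →* ℂˣ)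
    (lam : Hecke.heckeAlgebra K k n →+* ℂ) :
    ∃ lam' : Hecke.heckeAlgebra K k n →+* ℂ,
      -- `lam'` is the twist of `lam` by `ψ`, and is determined by this
      (Hecke.IsTwist ψ lam lam' ∧ ∀ μ, Hecke.IsTwist ψ lam μ → μ = lam') ∧
      -- the space `ℂ𝓜` with its decomposition by classes is graded
      Hecke.IsGradedAction (Hecke.complexAction K k n) (Hecke.complexPart K k n) ∧
      -- eigenvectors in `ℂ𝓜`
      (∀ v : Hecke.ModularPoint K k n →₀ ℂ,
        Hecke.IsEigenvector (Hecke.complexAction K k n) lam v →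
        Hecke.IsEigenvector (Hecke.complexAction K k n) lam' (Hecke.twistVector ψ v)) ∧
      -- eigenvectors in any complex vector space on which the Hecke algebra acts, graded by classes
      (∀ (V : Type*) [AddCommGroup V] [Module ℂ V]
        (ρ : Hecke.heckeAlgebra K k n →+* Module.End ℂ V) (W : ClassGroup (𝓞 K) → Submodule ℂ V),
        Hecke.IsGradedAction ρ W →
        ∀ u : ClassGroup (𝓞 K) → V, (∀ c, u c ∈ W c) →
          Hecke.IsEigenvector ρ lam (∑ c, u c) →
          Hecke.IsEigenvector ρ lam' (∑ c, ((ψ⁻¹ c : ℂˣ) : ℂ) • u c)) := by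
  obtain ⟨lam', hlam⟩ := Hecke.exists_isTwist ψ lam
  refine ⟨lam', ⟨hlam, fun μ hμ => hμ.unique hlam⟩, Hecke.isGradedAction_complexPart,
    fun v hv => ?_, fun V _ _ ρ W hW u hu h => h.twist hlam hW hu⟩
  -- `twistVector ψ v` is by definition the general twist for the family of components of `v`.
  exact Hecke.IsEigenvector.twist hlam Hecke.isGradedAction_complexPart
    (fun c => Hecke.component_mem c v) (by rwa [Hecke.sum_component])
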